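/- Let $H$ be a complex separable Hilbert space, let $B(H)$ be the algebra of bounded linear operators on $H$ and $K(H)$ the ideal of compact operators. Call $T\in B(H)$ Fredholm if its image in the Calkin algebra $B(H)/K(H)$ is invertible; in that case $\ker T$ and $\ker T^*$ are finite-dimensional and the index of $T$ is $\operatorname{ind}(T)=\dim\ker T-\dim\ker T^*\in\mathbb Z$. Write $\mathrm{nil}_2=\{M\in B(H): M^2=0\}$ and $\mathfrak c(\mathrm{nil}_2)=\{MN-NM: M,N\in\mathrm{nil}_2\}$, and let $\mathrm{clos}$ denote closure in the operator norm. Proposition 4.18. Let $T\in B(H)$ be a Fredholm operator whose index is odd. Then there exists $\delta>0$ such that for all $M\in\mathrm{nil}_2$ and all $B\in B(H)$, $$\|T-(MB-BM)\|\ge\delta.$$ In particular, $T\notin\mathrm{clos}(\mathfrak c(\mathrm{nil}_2))$. -/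

import Mathlib

namespace SquareZero

noncomputable section

variable (H : Type*) [NormedAddCommGroup H] [InnerProductSpace ℂ H]

/-- The two-sided ideal of compact operators in the algebra of bounded operators on `H`. -/
def compactIdeal : TwoSidedIdeal (H →L[ℂ] H) :=
  TwoSidedIdeal.mk' {K : H →L[ℂ] H | IsCompactOperator K}
    isCompactOperator_zero
    (fun hx hy => IsCompactOperator.add hx hy)
    (fun hx => IsCompactOperator.neg hx)
    (fun {x _} hy => IsCompactOperator.clm_comp hy x)
    (fun {_ y} hx => IsCompactOperator.comp_clm hx y)

/-- The Calkin algebra: bounded operators modulo compact operators. -/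
abbrev Calkin : Type _ := (compactIdeal H).ringCon.Quotient

/-- The canonical quotient map onto the Calkin algebra. -/
def calkinMk : (H →L[ℂ] H) →+* Calkin H := (compactIdeal H).ringCon.mk'

variable {H}

/-- `T` is Fredholm if its image in the Calkin algebra is invertible. -/
def IsFredholm (T : H →L[ℂ] H) : Prop := IsUnit (calkinMk H T)

/-- The Fredholm index `dim ker T - dim ker T*`. It is only meaningful for Fredholm operators,
for which both dimensions are finite. -/
def index [CompleteSpace H] (T : H →L[ℂ] H) : ℤ :=
  (Module.finrank ℂ T.ker : ℤ) - (Module.finrank ℂ (ContinuousLinearMap.adjoint T).ker : ℤ)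

variable (H) in
/-- The square-zero bounded operators on `H`. -/
def nilTwo : Set (H →L[ℂ] H) := {M | M ^ 2 = 0}

/-- The set of commutators `A B - B A` with both `A` and `B` in `Ω`. -/
def commutators (Ω : Set (H →L[ℂ] H)) : Set (H →L[ℂ] H) :=
  {C | ∃ A ∈ Ω, ∃ B ∈ Ω, C = A * B - B * A}

end

end SquareZero

/-! Let `C = MB - BM` with `M² = 0`. Then `MC = -CM`, so `C` preserves `ker M`, and on `H / ker M ≅
ran M` it induces `-C` restricted to `ran M`. With `j : ran M → ker M` the inclusion and `C' : ker M
→ ran M` the restriction of `C`, the two pieces are `jC'` and `-C'j`. If `C` has finite-dimensional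
kernel and cokernel, additivity along `0 → ker M → H → ran M → 0` gives `ind C = 2 (ind j + ind
C')`, which is even. This part is pure linear algebra. Analysis enters only through local constancy
of the index: an operator close to `T` has the odd index of `T`, so it cannot be such a `C`. -/

namespace LinearMap

open Function Module

/-! ### Additivity of the index, from the snake lemma -/

section ShortExact

variable {k M₁ M₂ M₃ : Type*} [Field k] [AddCommGroup M₁] [Module k M₁]
  [AddCommGroup M₂] [Module k M₂] [AddCommGroup M₃] [Module k M₃]

/-- The index is additive along an endomorphism of a short exact sequence. -/
theorem finiteDimensional_and_index_eq_add_of_exact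
    (i₁ : M₁ →ₗ[k] M₁) (i₂ : M₂ →ₗ[k] M₂) (i₃ : M₃ →ₗ[k] M₃)
    (f : M₁ →ₗ[k] M₂) (g : M₂ →ₗ[k] M₃) (hfg : Exact f g)
    (hf : Injective f) (hg : Surjective g)
    (h₁ : f ∘ₗ i₁ = i₂ ∘ₗ f) (h₂ : g ∘ₗ i₂ = i₃ ∘ₗ g)
    [FiniteDimensional k i₂.ker] [FiniteDimensional k (M₂ ⧸ i₂.range)]
    [FiniteDimensional k i₃.ker] :
    FiniteDimensional k i₁.ker ∧ FiniteDimensional k (M₁ ⧸ i₁.range) ∧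
      FiniteDimensional k (M₃ ⧸ i₃.range) ∧ i₂.index = i₁.index + i₃.index := by
  have h₁' (x) : f (i₁ x) = i₂ (f x) := congr($h₁ x)
  have h₂' (x) : g (i₂ x) = i₃ (g x) := congr($h₂ x)
  let F₀ : i₁.ker →ₗ[k] i₂.ker := f.restrict fun x hx ↦ by
    simp only [mem_ker] at hx ⊢
    rw [← h₁', hx, map_zero]
  let F₁ : i₂.ker →ₗ[k] i₃.ker := g.restrict fun x hx ↦ by
    simp only [mem_ker] at hx ⊢
    rw [← h₂', hx, map_zero]
  let F₃ : (M₁ ⧸ i₁.range) →ₗ[k] M₂ ⧸ i₂.range := i₁.range.mapQ i₂.range f <| by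
    rintro _ ⟨x, rfl⟩
    exact ⟨f x, (h₁' x).symm⟩
  let F₄ : (M₂ ⧸ i₂.range) →ₗ[k] M₃ ⧸ i₃.range := i₂.range.mapQ i₃.range g <| by
    rintro _ ⟨x, rfl⟩
    exact ⟨g x, (h₂' x).symm⟩
  let δ : i₃.ker →ₗ[k] M₁ ⧸ i₁.range :=
    SnakeLemma.δ' i₁ i₂ i₃ f g hfg f g hfg h₁ h₂ i₃.ker.subtype (exact_subtype_ker_map i₃)
      i₁.range.mkQ (exact_map_mkQ_range i₁) hg hf
  have e₀ : Injective F₀ := fun x y hxy ↦ Subtype.ext (hf congr(($hxy : M₂)))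
  have e₁ : Exact F₀ F₁ := by
    rintro ⟨y, hy⟩
    constructor
    · intro h
      obtain ⟨x, rfl⟩ := (hfg y).1 congr(($h : M₃))
      refine ⟨⟨x, hf ?_⟩, rfl⟩
      rw [h₁', map_zero]
      exact hy
    · rintro ⟨x, hx⟩
      have hx' : f x = y := congr(($hx : M₂))
      exact Subtype.ext ((hfg y).2 ⟨x, hx'⟩)
  have e₂ : Exact F₁ δ :=
    SnakeLemma.exact_δ'_right i₁ i₂ i₃ f g hfg f g hfg h₁ h₂ i₂.ker.subtype
      (exact_subtype_ker_map i₂) _ _ _ _ hg hf F₁ rfl i₃.ker.injective_subtype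
  have e₃ : Exact δ F₃ :=
    SnakeLemma.exact_δ'_left i₁ i₂ i₃ f g hfg f g hfg h₁ h₂ _ _ _ _ i₂.range.mkQ
      (exact_map_mkQ_range i₂) hg hf F₃ rfl i₁.range.mkQ_surjective
  have e₄ : Exact F₃ F₄ := by
    intro y
    obtain ⟨y, rfl⟩ := i₂.range.mkQ_surjective y
    constructor
    · intro h
      obtain ⟨z, hz⟩ : g y ∈ i₃.range := (Submodule.Quotient.mk_eq_zero _).1 h
      obtain ⟨w, rfl⟩ := hg z
      rw [← h₂', eq_comm, ← sub_eq_zero, ← map_sub] at hz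
      obtain ⟨x, hx⟩ := (hfg _).1 hz
      refine ⟨i₁.range.mkQ x, (Submodule.Quotient.eq i₂.range).2 ⟨-w, ?_⟩⟩
      simp [hx]
    · rintro ⟨x, hx⟩
      obtain ⟨x, rfl⟩ := i₁.range.mkQ_surjective x
      rw [← hx]
      have : g (f x) = 0 := hfg.apply_apply_eq_zero x
      exact (Submodule.Quotient.mk_eq_zero _).2 (this ▸ zero_mem _)
  have e₅ : Surjective F₄ := by
    intro y
    obtain ⟨y, rfl⟩ := i₃.range.mkQ_surjective y
    obtain ⟨x, rfl⟩ := hg y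
    exact ⟨i₂.range.mkQ x, rfl⟩
  have d₁ : FiniteDimensional k i₁.ker := .of_injective F₀ e₀
  have d₃ : FiniteDimensional k (M₃ ⧸ i₃.range) := .of_surjective F₄ e₅
  have d₂ : FiniteDimensional k (M₁ ⧸ i₁.range) := by
    have : FiniteDimensional k F₃.ker := by rw [e₃.linearMap_ker_eq]; infer_instance
    have : FiniteDimensional k ((M₁ ⧸ i₁.range) ⧸ F₃.ker) :=
      F₃.quotKerEquivRange.symm.finiteDimensional
    exact Module.Finite.of_submodule_quotient F₃.ker
  refine ⟨d₁, d₂, d₃, ?_⟩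
  have := sum_neg_one_pow_finrank_eq_zero_of_exact_six F₀ F₁ δ F₃ F₄ e₀ e₁ e₂ e₃ e₄ e₅
  simp only [index_eq_finrank_sub]
  lia

end ShortExact

/-! ### Parity of the index of a commutator -/

section Commutator

variable {k V : Type*} [Field k] [AddCommGroup V] [Module k V]

/-- If `M` has square zero and `M * B - B * M` has finite-dimensional kernel and cokernel, then its
index is even. -/
theorem even_index_commutator_of_sq_eq_zero {M B : V →ₗ[k] V} (hM : ∀ x, M (M x) = 0)
    [FiniteDimensional k (M ∘ₗ B - B ∘ₗ M).ker]
    [FiniteDimensional k (V ⧸ (M ∘ₗ B - B ∘ₗ M).range)] :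
    Even (M ∘ₗ B - B ∘ₗ M).index := by
  set C := M ∘ₗ B - B ∘ₗ M with hC
  have hCx (x) : C x = M (B x) - B (M x) := rfl
  have hMC (x) : M (C x) = -C (M x) := by simp [hCx, hM]
  let j : M.range →ₗ[k] M.ker := Submodule.inclusion <| by
    rintro _ ⟨x, rfl⟩
    exact hM x
  -- On `ker M` the term `BM` vanishes, so `C = MB` there and lands in `ran M`.
  let C' : M.ker →ₗ[k] M.range := C.restrict fun x hx ↦ by
    rw [mem_ker] at hx
    rw [hCx, hx, map_zero, sub_zero]
    exact ⟨_, rfl⟩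
  have hker : (-(C' ∘ₗ j)).ker ≤ C.ker.comap M.range.subtype := by
    intro x hx
    rw [ker_neg] at hx
    exact congr(($hx : V))
  have : FiniteDimensional k (C.ker.comap M.range.subtype) :=
    .of_injective (M.range.subtype.restrict (p := C.ker.comap M.range.subtype) (q := C.ker)
      fun x hx ↦ hx) fun x y hxy ↦ Subtype.ext (Subtype.ext congr(($hxy : V)))
  have hfin : FiniteDimensional k (-(C' ∘ₗ j)).ker := Submodule.finiteDimensional_of_le hker
  obtain ⟨d₁, d₂, d₃, hadd⟩ := finiteDimensional_and_index_eq_add_of_exact (j ∘ₗ C') C (-(C' ∘ₗ j))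
    M.ker.subtype M.rangeRestrict
    (fun x ↦ ⟨fun h ↦ ⟨⟨x, congr(($h : V))⟩, rfl⟩, by rintro ⟨x, rfl⟩; exact Subtype.ext x.2⟩)
    M.ker.injective_subtype M.surjective_rangeRestrict
    rfl (ext fun x ↦ Subtype.ext (hMC x))
  rw [index_neg] at hadd
  rw [range_neg] at d₃
  -- Finiteness for `jC'` and `C'j` passes to each factor, so the index of each composite splits as
  -- a sum.
  have : FiniteDimensional k j.ker := by
    rw [ker_eq_bot.2 (Submodule.inclusion_injective _)]; infer_instance
  have : FiniteDimensional k C'.ker := Submodule.finiteDimensional_of_le (ker_le_ker_comp C' j)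
  have : FiniteDimensional k (M.ker ⧸ j.range) :=
    .of_surjective _ (Submodule.factor_surjective (range_comp_le_range C' j))
  have : FiniteDimensional k (M.range ⧸ C'.range) :=
    .of_surjective _ (Submodule.factor_surjective (range_comp_le_range j C'))
  rw [index_comp, index_comp, add_comm C'.index] at hadd
  exact ⟨_, hadd⟩

end Commutator

/-! ### Index through a bijective compression -/

section Compression

variable {k V W V' W' : Type*} [Field k] [AddCommGroup V] [Module k V] [AddCommGroup W]
  [Module k W] [AddCommGroup V'] [Module k V'] [AddCommGroup W'] [Module k W']

/-- A linear map with a bijective compression of finite codimension has finite-dimensional kernel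
and cokernel, and its index depends only on the compression data. -/
theorem finiteDimensional_and_index_eq_of_bijective_comp {i : V' →ₗ[k] V} {p : W →ₗ[k] W'}
    {S : V →ₗ[k] W} (hi : Injective i) (hp : Surjective p) [FiniteDimensional k (V ⧸ i.range)]
    [FiniteDimensional k p.ker] (hS : Bijective (p ∘ₗ S ∘ₗ i)) :
    FiniteDimensional k S.ker ∧ FiniteDimensional k (W ⧸ S.range) ∧
      S.index = -(p.index + i.index) := by
  have d₁ : FiniteDimensional k S.ker := by
    refine .of_injective (i.range.mkQ ∘ₗ S.ker.subtype) <| (injective_iff_map_eq_zero _).2 ?_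
    rintro ⟨x, hx⟩ h
    obtain ⟨y, rfl⟩ := (Submodule.Quotient.mk_eq_zero _).1 h
    have : y = 0 := hS.1 <| by
      have : S (i y) = 0 := hx
      simp [this]
    simp [this]
  have d₂ : FiniteDimensional k (W ⧸ S.range) := by
    refine .of_surjective (S.range.mkQ ∘ₗ p.ker.subtype) fun w ↦ ?_
    obtain ⟨w, rfl⟩ := S.range.mkQ_surjective w
    obtain ⟨y, hy⟩ := hS.2 (p w)
    refine ⟨⟨w - S (i y), by simpa [sub_eq_zero] using hy.symm⟩, ?_⟩
    exact (Submodule.Quotient.eq _).2 ⟨-i y, by simp⟩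
  refine ⟨d₁, d₂, ?_⟩
  have : FiniteDimensional k i.ker := by rw [ker_eq_bot.2 hi]; infer_instance
  have : FiniteDimensional k (W' ⧸ p.range) := by rw [range_eq_top.2 hp]; infer_instance
  have : FiniteDimensional k (S ∘ₗ i).ker := by
    rw [ker_eq_bot.2 (Injective.of_comp (f := p) hS.1)]; infer_instance
  have : FiniteDimensional k (W ⧸ (S ∘ₗ i).range) := by
    rw [range_comp]; infer_instance
  have h₀ : (p ∘ₗ S ∘ₗ i).index = 0 := (LinearEquiv.ofBijective _ hS).index_eq_zero
  rw [index_comp, index_comp] at h₀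
  lia

end Compression

end LinearMap

/-! ### Compact perturbations and stability of the index -/

namespace ContinuousLinearMap

open Topology
open scoped LinearMap.FiniteRangeSetoid

variable {H : Type*} [NormedAddCommGroup H] [InnerProductSpace ℂ H]

/-- Compact operators into an inner product space are norm limits of finite rank operators. -/
theorem exists_hasFiniteRange_norm_sub_lt {K : H →L[ℂ] H} (hK : IsCompactOperator K) {ε : ℝ}
    (hε : 0 < ε) : ∃ F : H →L[ℂ] H, F.toLinearMap.HasFiniteRange ∧ ‖K - F‖ < ε := by
  obtain ⟨t, -, ht, hcover⟩ := exists_finite_cover_balls_of_isCompact_closure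
    (hK.isCompact_closure_image_closedBall (𝕜₁ := ℂ) 1) (half_pos hε)
  have : FiniteDimensional ℂ (Submodule.span ℂ t) := .span_of_finite ℂ ht
  -- `t` is a finite `ε/2`-net for the image of the unit ball; projecting onto its span moves `K x`
  -- no further than the nearest net point.
  let P := (Submodule.span ℂ t).starProjection
  refine ⟨P ∘L K, ?_, ?_⟩
  · refine LinearMap.HasFiniteRange.comp_right (v := P.toLinearMap) ?_ _
    rw [LinearMap.HasFiniteRange, Submodule.range_starProjection]
    exact Submodule.FG.of_finite
  · refine lt_of_le_of_lt ?_ (half_lt_self hε)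
    refine opNorm_le_of_unit_norm (𝕜 := ℂ) (half_pos hε).le fun x hx ↦ ?_
    have hx' : K x ∈ K '' Metric.closedBall 0 1 := ⟨x, by simp [hx], rfl⟩
    obtain ⟨y, hy, hxy⟩ := Set.mem_iUnion₂.1 (hcover hx')
    have hmin : ‖K x - P (K x)‖ ≤ ‖K x - y‖ := by
      rw [Submodule.starProjection_minimal]
      exact ciInf_le ⟨0, by rintro _ ⟨z, rfl⟩; exact norm_nonneg _⟩
        (⟨y, Submodule.subset_span hy⟩ : Submodule.span ℂ t)
    rw [Metric.mem_ball, dist_eq_norm] at hxy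
    exact hmin.trans hxy.le

variable [CompleteSpace H]

/-- A finite rank `F` with `‖K - F‖ < 1` makes `1 + K` a finite rank perturbation of the invertible
`1 + (K - F)`. -/
theorem isFredholm_one_add_of_isCompactOperator {K : H →L[ℂ] H} (hK : IsCompactOperator K) :
    IsFredholm (1 + K) := by
  obtain ⟨F, hF, hlt⟩ := exists_hasFiniteRange_norm_sub_lt hK one_pos
  obtain ⟨u, hu⟩ : IsUnit (1 - -(K - F)) := isUnit_one_sub_of_norm_lt_one (by rwa [norm_neg])
  let e := ContinuousLinearEquiv.unitsEquiv ℂ H u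
  have he : (e : H →L[ℂ] H) = 1 + (K - F) := by
    rw [← sub_neg_eq_add, ← hu]; rfl
  refine .of_isQuasiInverse (v := (e.symm : H →L[ℂ] H)) ?_
  refine (LinearEquiv.isQuasiInverse e.toLinearEquiv).congr (Setoid.refl e.toLinearEquiv.symm.toLinearMap) ?_
  rw [LinearMap.FiniteRangeSetoid.equiv_iff_hasFiniteRange]
  have : (1 + K).toLinearMap - (e : H →L[ℂ] H).toLinearMap = F.toLinearMap := by
    rw [he]; ext x; simp
  exact this ▸ hF

/-- The index is locally constant at operators with finite-dimensional kernel and cokernel. -/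
theorem eventually_index_eq (T : H →L[ℂ] H) [FiniteDimensional ℂ T.ker]
    [FiniteDimensional ℂ (H ⧸ T.range)] (hT : IsClosed (T.range : Set H)) :
    ∀ᶠ S : H →L[ℂ] H in 𝓝 T, FiniteDimensional ℂ S.ker ∧ FiniteDimensional ℂ (H ⧸ S.range) ∧
      S.toLinearMap.index = T.toLinearMap.index := by
  have : CompleteSpace T.range := hT.completeSpace_coe
  have : CompleteSpace T.ker := T.isClosed_ker.completeSpace_coe
  let i := (T.ker)ᗮ.subtypeL
  let p := T.range.orthogonalProjectionOnto
  have hi : Function.Injective i := Subtype.val_injective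
  have hp : Function.Surjective p := fun y ↦ ⟨y, by simp [p]⟩
  have hpT (x : H) : p (T x) = ⟨T x, x, rfl⟩ :=
    T.range.orthogonalProjectionOnto_mem_subspace_eq_self ⟨T x, x, rfl⟩
  have : FiniteDimensional ℂ (H ⧸ i.range) := by
    rw [show i.range = (T.ker)ᗮ from Submodule.range_subtype _]
    exact (Submodule.quotientEquivOfIsCompl _ _
      (Submodule.isCompl_orthogonal _).symm).symm.finiteDimensional
  have : FiniteDimensional ℂ p.ker := by
    rw [show p.ker = T.rangeᗮ from Submodule.ker_orthogonalProjectionOnto]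
    exact (Submodule.quotientEquivOfIsCompl _ _
      (Submodule.isCompl_orthogonal _)).finiteDimensional
  -- `T` maps `(ker T)ᗮ` bijectively onto `ran T`; invertibility of this compression is an open
  -- condition on the operator.
  have hbij : Function.Bijective (p ∘L T ∘L i) := by
    constructor
    · refine (injective_iff_map_eq_zero _).2 fun x hx ↦ ?_
      have hTx : T x = 0 := by
        have := hpT x
        rw [show p (T x) = 0 from hx] at this
        exact congr(($this : H)).symm
      exact Subtype.ext <| (Submodule.disjoint_def.1 T.ker.orthogonal_disjoint) x hTx x.2
    · rintro ⟨_, x, rfl⟩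
      refine ⟨⟨x - T.ker.starProjection x, T.ker.sub_starProjection_mem_orthogonal x⟩, ?_⟩
      have hx : T (T.ker.starProjection x) = 0 := T.ker.starProjection_apply_mem x
      change p (T (x - _)) = _
      rw [map_sub, hx, sub_zero, hpT]
      rfl
  have hcont : Continuous fun S : H →L[ℂ] H ↦ p ∘L S ∘L i := by fun_prop
  let e := ContinuousLinearEquiv.ofBijective (p ∘L T ∘L i)
    (LinearMap.ker_eq_bot.2 hbij.1) (LinearMap.range_eq_top.2 hbij.2)
  have he : (e : (T.ker)ᗮ →L[ℂ] T.range) = p ∘L T ∘L i := by ext; rfl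
  have hT' := LinearMap.finiteDimensional_and_index_eq_of_bijective_comp (i := i.toLinearMap)
    (p := p.toLinearMap) (S := T.toLinearMap) hi hp hbij
  filter_upwards [hcont.continuousAt.preimage_mem_nhds (he ▸ e.nhds)] with S ⟨e', he'⟩
  have hbij' : Function.Bijective (p ∘L S ∘L i) := by
    rw [← show (e' : (T.ker)ᗮ →L[ℂ] T.range) = p ∘L S ∘L i from he']
    exact e'.bijective
  have hS := LinearMap.finiteDimensional_and_index_eq_of_bijective_comp (i := i.toLinearMap)
    (p := p.toLinearMap) (S := S.toLinearMap) hi hp hbij'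
  exact ⟨hS.1, hS.2.1, hS.2.2.trans hT'.2.2.symm⟩

/-- Restricting to `(ker T)ᗮ` makes `T` injective with the same range, which has a
finite-dimensional, hence closed, complement. -/
theorem isClosed_range_of_finiteDimensional_coker (T : H →L[ℂ] H)
    [FiniteDimensional ℂ (H ⧸ T.range)] : IsClosed (T.range : Set H) := by
  have : CompleteSpace T.ker := T.isClosed_ker.completeSpace_coe
  obtain ⟨G, hG⟩ := Submodule.exists_isCompl T.range
  have : FiniteDimensional ℂ G := (Submodule.quotientEquivOfIsCompl _ _ hG).finiteDimensional
  let f := T ∘L (T.ker)ᗮ.subtypeL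
  have hf : f.range = T.range := by
    refine le_antisymm (LinearMap.range_comp_le_range _ _) ?_
    rintro _ ⟨x, rfl⟩
    refine ⟨⟨x - T.ker.starProjection x, T.ker.sub_starProjection_mem_orthogonal x⟩, ?_⟩
    have hx : T (T.ker.starProjection x) = 0 := T.ker.starProjection_apply_mem x
    change T (x - _) = T x
    rw [map_sub, hx, sub_zero]
  rw [← hf] at hG ⊢
  refine f.closed_complemented_range_of_isCompl_of_ker_eq_bot G hG G.closed_of_finiteDimensional ?_
  refine LinearMap.ker_eq_bot'.2 fun x hx ↦ Subtype.ext ?_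
  exact (Submodule.disjoint_def.1 T.ker.orthogonal_disjoint) x hx x.2

end ContinuousLinearMap

/-! ### From the Calkin algebra to the algebraic index -/

namespace SquareZero

variable {H : Type*} [NormedAddCommGroup H] [InnerProductSpace ℂ H]

theorem calkinMk_eq_iff {S T : H →L[ℂ] H} :
    calkinMk H S = calkinMk H T ↔ IsCompactOperator (S - T) := by
  refine (RingCon.eq _).trans ?_
  rw [TwoSidedIdeal.rel_iff]
  exact TwoSidedIdeal.mem_mk' _ _ _ _ _ _ _

variable [CompleteSpace H]

/-- Atkinson's argument: for a lift `S` of the Calkin inverse, `ST` and `TS` are compact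
perturbations of `1`; the first controls `ker T`, the second the cokernel. -/
theorem IsFredholm.finiteDimensional {T : H →L[ℂ] H} (hT : IsFredholm T) :
    FiniteDimensional ℂ T.ker ∧ FiniteDimensional ℂ (H ⧸ T.range) := by
  obtain ⟨a, hTa, haT⟩ := isUnit_iff_exists.1 hT
  obtain ⟨S, rfl⟩ := RingCon.mk'_surjective _ a
  change calkinMk H T * calkinMk H S = 1 at hTa
  change calkinMk H S * calkinMk H T = 1 at haT
  rw [← map_mul, ← map_one (calkinMk H), calkinMk_eq_iff] at hTa haT
  have h₁ := ContinuousLinearMap.isFredholm_one_add_of_isCompactOperator (K := T * S - 1) hTa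
  have h₂ := ContinuousLinearMap.isFredholm_one_add_of_isCompactOperator (K := S * T - 1) haT
  rw [add_sub_cancel] at h₁ h₂
  have : FiniteDimensional ℂ (S.toLinearMap ∘ₗ T.toLinearMap).ker := h₂.finite_ker
  have : FiniteDimensional ℂ (H ⧸ (T.toLinearMap ∘ₗ S.toLinearMap).range) := h₁.finite_coker
  exact ⟨Submodule.finiteDimensional_of_le
      (LinearMap.ker_le_ker_comp T.toLinearMap S.toLinearMap),
    .of_surjective _ (Submodule.factor_surjective
      (LinearMap.range_comp_le_range S.toLinearMap T.toLinearMap))⟩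

theorem index_eq_linearMap_index {T : H →L[ℂ] H} (hT : IsClosed (T.range : Set H)) :
    index T = T.toLinearMap.index := by
  have : CompleteSpace T.range := hT.completeSpace_coe
  rw [index, LinearMap.index_eq_finrank_sub, ← T.orthogonal_range,
    (Submodule.quotientEquivOfIsCompl _ _
      (T.range).isCompl_orthogonal).finrank_eq]

end SquareZero

theorem proposition4p18 {H : Type*} [NormedAddCommGroup H] [InnerProductSpace ℂ H]
    [CompleteSpace H] [TopologicalSpace.SeparableSpace H]
    (T : H →L[ℂ] H) (hT : SquareZero.IsFredholm T) (hodd : Odd (SquareZero.index T)) :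
    (∃ δ : ℝ, 0 < δ ∧ ∀ M ∈ SquareZero.nilTwo H, ∀ B : H →L[ℂ] H,
      δ ≤ ‖T - (M * B - B * M)‖) ∧
    T ∉ closure (SquareZero.commutators (SquareZero.nilTwo H)) := by
  have h : ∃ δ : ℝ, 0 < δ ∧ ∀ M ∈ SquareZero.nilTwo H, ∀ B : H →L[ℂ] H,
      δ ≤ ‖T - (M * B - B * M)‖ := by
    obtain ⟨_, _⟩ := hT.finiteDimensional
    have hcl := T.isClosed_range_of_finiteDimensional_coker
    obtain ⟨δ, hδ, hball⟩ := Metric.eventually_nhds_iff_ball.1 (T.eventually_index_eq hcl)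
    refine ⟨δ, hδ, fun M hM B ↦ ?_⟩
    by_contra! hlt
    obtain ⟨hker, hcoker, hindex⟩ := hball (M * B - B * M) <| by
      rwa [Metric.mem_ball, dist_comm, dist_eq_norm]
    have hMM (x : H) : M (M x) = 0 := by
      have : M ^ 2 = 0 := hM
      rw [sq] at this
      exact congr($this x)
    have hC : (M * B - B * M).toLinearMap =
        M.toLinearMap ∘ₗ B.toLinearMap - B.toLinearMap ∘ₗ M.toLinearMap := LinearMap.ext fun _ ↦ rfl
    rw [hC] at hker hcoker hindex
    have heven := LinearMap.even_index_commutator_of_sq_eq_zero (M := M.toLinearMap)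
      (B := B.toLinearMap) hMM
    rw [SquareZero.index_eq_linearMap_index hcl, ← hindex] at hodd
    exact Int.not_even_iff_odd.2 hodd heven
  refine ⟨h, fun hT' ↦ ?_⟩
  obtain ⟨δ, hδ, hle⟩ := h
  obtain ⟨_, ⟨M, hM, B, -, rfl⟩, hlt⟩ := Metric.mem_closure_iff.1 hT' δ hδ
  exact (hle M hM B).not_gt (by rwa [← dist_eq_norm])
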